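/- Let $m,n,q$ be integers with $m,n\ge 0$, $q\ge 1$, let $P\in\mathbb{R}^{q\times n}$, $B\in\mathbb{R}^{m\times n}$ and $a\in(\mathbb{R}\cup\{-\infty\})^m$. Consider the multiple objective linear program $$\min Px\quad\text{subject to}\quad a\le Bx,$$ with feasible set $S=\{x\in\mathbb{R}^n: a\le Bx\}$ and upper image $\mathcal{P}=P[S]+\mathbb{R}^q_+$. Let $e=(1,\dots,1)^T\in\mathbb{R}^q$, let $$T=\{(u,w)\in\mathbb{R}^m\times\mathbb{R}^q:\ B^Tu=P^Tw,\ u\ge 0,\ w\ge 0,\ e^Tw=1\},$$ $D(u,w)=(w_1,\dots,w_{q-1},a^Tu)^T$ (with $-\infty\cdot 0=0$), $K=\{y\in\mathbb{R}^q: y_1=\dots=y_{q-1}=0,\ y_q\ge 0\}$, and let $\mathcal{D}=D(T)-K\subseteq\mathbb{R}^q$ be the lower image of the dual problem (pairs $(u,w)\in T$ with $a^Tu=-\infty$ contribute nothing). For a point or direction $y\in\mathbb{R}^q$ and $y^*\in\mathbb{R}^q$ put $$\varphi(y,y^*)=\sum_{i=1}^{q-1}y_iy_i^*+y_q\Bigl(1-\sum_{i=1}^{q-1}y_i^*\Bigr)-\xi(y)\,y_q^*,$$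 where $\xi(y)=1$ if $y$ is a point and $\xi(y)=0$ if $y$ is a direction. A V-representation of a set $Q\subseteq\mathbb{R}^q$ is a finite set of points and nonzero directions such that $Q$ is the convex hull of the points plus the convex cone generated by the directions; an H-representation of $Q$ is a finite system of linear inequalities, each describing an affine half-space, whose solution set is $Q$. Either one is irredundant if no element (no inequality of the system, respectively) can be left out. Assume that $\mathcal{P}$ has a vertex. Then: (i) If $q\ge 2$, a finite set $\bar Y$ of points and directions in $\mathbb{R}^q$ is an irredundant V-representation of $\mathcal{P}$ if and only if the system of inequalities $\varphi(y,y^*)\ge 0$, $y\in\bar Y$, in the variable $y^*\in\mathbb{R}^q$, is an irredundant H-representation of $\mathcal{D}$. (ii) A finite set $\bar W\subseteq\mathbb{R}^q$ of points together with the direction $(0,\dots,0,-1)^T$ is an irredundant V-representation of $\mathcal{D}$ if and only if the system of inequalities $\varphi(y,y^*)\ge 0$, $y^*\in\bar W$, in the variable point $y\in\mathbb{R}^q$, is an irredundant H-representation of $\mathcal{P}$. -/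

import Mathlib

open scoped Pointwise Matrix

namespace MOLP

/-- A generator of a polyhedron in `ℝ^q`: a point or a direction. -/
inductive Gen (q : ℕ) : Type
  | point (y : Fin q → ℝ) : Gen q
  | direction (y : Fin q → ℝ) : Gen q

/-- The vector underlying a point or a direction. -/
def Gen.vec {q : ℕ} : Gen q → (Fin q → ℝ)
  | .point y => y
  | .direction y => y

/-- `ξ` is `1` on points and `0` on directions. -/
def Gen.xi {q : ℕ} : Gen q → ℝ
  | .point _ => 1
  | .direction _ => 0

/-- `Y` is a V-representation of `Q`: `Y` is a finite set of points and (nonzero) directions and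
`Q` is the convex hull of the points plus the convex cone generated by the directions. -/
def IsVRep {q : ℕ} (Y : Set (Gen q)) (Q : Set (Fin q → ℝ)) : Prop :=
  Y.Finite ∧ Gen.direction 0 ∉ Y ∧
    convexHull ℝ {y | Gen.point y ∈ Y} +
      (PointedCone.hull ℝ {y | Gen.direction y ∈ Y} : Set (Fin q → ℝ)) = Q

/-- An irredundant V-representation: no element can be left out. -/
def IsIrredundantVRep {q : ℕ} (Y : Set (Gen q)) (Q : Set (Fin q → ℝ)) : Prop :=
  IsVRep Y Q ∧ ∀ g ∈ Y, ¬ IsVRep (Y \ {g}) Q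

/-- Closed affine half-spaces of `ℝ^q`. -/
def IsHalfspace {q : ℕ} (H : Set (Fin q → ℝ)) : Prop :=
  ∃ (c : Fin q → ℝ) (β : ℝ), c ≠ 0 ∧ H = {z | β ≤ c ⬝ᵥ z}

/-- The inequalities `f i z ≥ 0`, `i ∈ I`, form an H-representation of `Q`: there are finitely
many of them, each one describes an affine half-space, and `Q` is their solution set. -/
def IsHRep {ι : Type*} {q : ℕ} (I : Set ι) (f : ι → (Fin q → ℝ) → ℝ) (Q : Set (Fin q → ℝ)) :
    Prop :=
  I.Finite ∧ (∀ i ∈ I, IsHalfspace {z | 0 ≤ f i z}) ∧ {z | ∀ i ∈ I, 0 ≤ f i z} = Q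

/-- An irredundant H-representation: no inequality of the system can be left out. -/
def IsIrredundantHRep {ι : Type*} {q : ℕ} (I : Set ι) (f : ι → (Fin q → ℝ) → ℝ)
    (Q : Set (Fin q → ℝ)) : Prop :=
  IsHRep I f Q ∧ ∀ i ∈ I, ¬ IsHRep (I \ {i}) f Q

variable {m n d : ℕ}

/-- The feasible set `S = {x | a ≤ B x}`; an entry `-∞` of `a` means no constraint. -/
def feasibleSet (a : Fin m → EReal) (B : Matrix (Fin m) (Fin n) ℝ) : Set (Fin n → ℝ) :=
  {x | ∀ i, a i ≤ (((B *ᵥ x) i : ℝ) : EReal)}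

/-- The upper image `P[S] + ℝ^q_+`, with `q = d + 1`. -/
def upperImage (a : Fin m → EReal) (B : Matrix (Fin m) (Fin n) ℝ)
    (P : Matrix (Fin (d + 1)) (Fin n) ℝ) : Set (Fin (d + 1) → ℝ) :=
  (fun x => P *ᵥ x) '' feasibleSet a B + {y | 0 ≤ y}

/-- The dual feasible set
`T = {(u, w) | Bᵀ u = Pᵀ w, u ≥ 0, w ≥ 0, eᵀ w = 1}`. -/
def dualFeasibleSet (B : Matrix (Fin m) (Fin n) ℝ) (P : Matrix (Fin (d + 1)) (Fin n) ℝ) :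
    Set ((Fin m → ℝ) × (Fin (d + 1) → ℝ)) :=
  {p | Bᵀ *ᵥ p.1 = Pᵀ *ᵥ p.2 ∧ 0 ≤ p.1 ∧ 0 ≤ p.2 ∧ ∑ i, p.2 i = 1}

/-- The dual objective `D(u, w) = (w_1, …, w_{q-1}, aᵀ u)`, where `-∞ * 0 = 0` (the convention
of `EReal`); its last entry is `-∞` if `u_i > 0` for some `i` with `a_i = -∞`. -/
noncomputable def dualObjective (a : Fin m → EReal)
    (p : (Fin m → ℝ) × (Fin (d + 1) → ℝ)) : Fin (d + 1) → EReal :=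
  Fin.snoc (α := fun _ => EReal) (fun i : Fin d => ((p.2 i.castSucc : ℝ) : EReal))
    (∑ i, a i * ((p.1 i : ℝ) : EReal))

/-- The ordering cone `K` of the dual problem. -/
def dualCone (d : ℕ) : Set (Fin (d + 1) → ℝ) :=
  {k | (∀ i : Fin d, k i.castSucc = 0) ∧ 0 ≤ k (Fin.last d)}

/-- The lower image `D(T) - K` of the dual problem, a subset of `ℝ^q`. -/
def lowerImage (a : Fin m → EReal) (B : Matrix (Fin m) (Fin n) ℝ)
    (P : Matrix (Fin (d + 1)) (Fin n) ℝ) : Set (Fin (d + 1) → ℝ) :=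
  {z | ∃ p ∈ dualFeasibleSet B P, ∃ k ∈ dualCone d,
    ∀ i, ((z i : ℝ) : EReal) = dualObjective a p i - ((k i : ℝ) : EReal)}

/-- The coupling function
`φ(y, y*) = ∑_{i<q} y_i y*_i + y_q (1 - ∑_{i<q} y*_i) - ξ(y) y*_q`. -/
noncomputable def coupling (y : Gen (d + 1)) (ys : Fin (d + 1) → ℝ) : ℝ :=
  ∑ i : Fin d, y.vec i.castSucc * ys i.castSucc
    + y.vec (Fin.last d) * (1 - ∑ i : Fin d, ys i.castSucc)
    - y.xi * ys (Fin.last d)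

/-- The direction `(0, …, 0, -1)`. -/
def downDirection (d : ℕ) : Fin (d + 1) → ℝ := -Pi.single (Fin.last d) 1

end MOLP

/-! Write `weight ys` for the vector w = (y*_1, …, y*_{q-1}, 1 - ∑ y*_i). For a point y, φ(y, y*) ≥
0 says y*_q ≤ w ⬝ᵥ y, and for a direction it says 0 ≤ w ⬝ᵥ y. Linear programming duality shows that
the upper and lower images determine each other through these inequalities (`mem_lowerImage_iff`,
`mem_upperImage_iff`).

Hence generators of one image give inequalities of the other. Conversely, a complete system of
inequalities yields generators by Farkas' lemma (`generated_eq_upperImage_iff`,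
`generated_withDown_eq_lowerImage_iff`). The converse in (i) is the delicate one: a half-space
containing all generators in Y may have a normal c with ∑ c_i ≤ 0, which no dual point represents. A
vertex together with q ≥ 2 makes the dual weights non-unique and removes this case. In (ii) all
weights already have sum 1, and only nonemptiness of the two images is used.

Irredundancy transfers because both equivalences hold for every finite family, so also after an
element is deleted. It remains to match the side conditions: nonzero directions on one side, genuine
half-spaces on the other, and the indispensable downward direction. -/

namespace MOLP

/-! ### Farkas' lemma and its affine variants. -/

section Farkas

variable {ι V : Type*} [AddCommGroup V] [Module ℝ V]

/-- **Farkas' lemma** for finitely many linear forms on a real vector space. -/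
theorem exists_nonneg_combination (s : Finset ι) :
    ∀ (f : ι → V →ₗ[ℝ] ℝ) (c : V →ₗ[ℝ] ℝ),
      (∀ x, (∀ i ∈ s, 0 ≤ f i x) → 0 ≤ c x) →
      ∃ l : ι → ℝ, (∀ i, 0 ≤ l i) ∧ ∀ x, c x = ∑ i ∈ s, l i * f i x := by
  classical
  induction s using Finset.induction_on with
  | empty =>
    intro f c h
    refine ⟨0, fun _ => le_rfl, fun x => ?_⟩
    have h1 := h x (by simp)
    have h2 := h (-x) (by simp)
    rw [map_neg] at h2
    simp only [Finset.sum_empty]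
    linarith
  | insert j s hj ih =>
    intro f c h
    by_cases hs : ∀ x, (∀ i ∈ s, 0 ≤ f i x) → 0 ≤ c x
    · obtain ⟨l, hl, hc⟩ := ih f c hs
      refine ⟨Function.update l j 0, fun i => ?_, fun x => ?_⟩
      · by_cases hi : i = j
        · simp [hi]
        · simpa [hi] using hl i
      · rw [Finset.sum_insert hj, hc x]
        simp only [Function.update_self, zero_mul, zero_add]
        refine Finset.sum_congr rfl fun i hi => ?_
        rw [Function.update_of_ne (ne_of_mem_of_not_mem hi hj)]
    · push Not at hs
      obtain ⟨z, hz, hcz⟩ := hs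
      have hjz : f j z < 0 := by
        by_contra hcon
        push Not at hcon
        refine absurd (h z fun i hi => ?_) (not_le.2 hcz)
        rcases Finset.mem_insert.1 hi with rfl | hi
        · exact hcon
        · exact hz i hi
      set r : ℝ := (-f j z)⁻¹ with hr
      have hr0 : 0 < r := inv_pos.2 (by linarith)
      have hrj : r * f j z = -1 := by
        rw [hr, inv_neg, neg_mul, inv_mul_cancel₀ hjz.ne]
      -- Each new form is the old one evaluated at x + (r * f j x) • z, the projection of x along z
      -- onto the kernel of `f j`. There the constraint `j` holds with equality and can be dropped.
      obtain ⟨l, hl, hc⟩ := ih (fun i => f i + (r * f i z) • f j) (c + (r * c z) • f j) (by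
        intro x hx
        have key : 0 ≤ c (x + (r * f j x) • z) := by
          refine h _ fun i hi => ?_
          rcases Finset.mem_insert.1 hi with rfl | hi
          · simp only [map_add, map_smul, smul_eq_mul]
            have : f i x + r * f i x * f i z = f i x * (1 + r * f i z) := by ring
            rw [this, hrj]; simp
          · have := hx i hi
            simp only [LinearMap.add_apply, LinearMap.smul_apply, smul_eq_mul] at this
            simp only [map_add, map_smul, smul_eq_mul]
            linarith
        simp only [map_add, map_smul, smul_eq_mul] at key
        simp only [LinearMap.add_apply, LinearMap.smul_apply, smul_eq_mul]
        linarith)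
      have hsum : 0 ≤ ∑ i ∈ s, l i * (r * f i z) :=
        Finset.sum_nonneg fun i hi => mul_nonneg (hl i) (mul_nonneg hr0.le (hz i hi))
      refine ⟨Function.update l j (∑ i ∈ s, l i * (r * f i z) - r * c z), fun i => ?_,
        fun x => ?_⟩
      · by_cases hi : i = j
        · subst hi
          rw [Function.update_self]
          have := mul_neg_of_pos_of_neg hr0 hcz
          linarith
        · simpa [hi] using hl i
      · rw [Finset.sum_insert hj, Function.update_self]
        have h1 := hc x
        simp only [LinearMap.add_apply, LinearMap.smul_apply, smul_eq_mul, mul_add,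
          Finset.sum_add_distrib] at h1
        have h2 : ∑ i ∈ s, Function.update l j (∑ i ∈ s, l i * (r * f i z) - r * c z) i * f i x
            = ∑ i ∈ s, l i * f i x := by
          refine Finset.sum_congr rfl fun i hi => ?_
          rw [Function.update_of_ne (ne_of_mem_of_not_mem hi hj)]
        have h3 : ∑ i ∈ s, l i * (r * f i z * f j x) = (∑ i ∈ s, l i * (r * f i z)) * f j x := by
          rw [Finset.sum_mul]
          exact Finset.sum_congr rfl fun i _ => by ring
        rw [h2, sub_mul]
        linarith

/-- The homogenization of the inequality `b ≤ f x`. -/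
noncomputable def homogenization (f : V →ₗ[ℝ] ℝ) (b : ℝ) : V × ℝ →ₗ[ℝ] ℝ :=
  f.comp (LinearMap.fst ℝ V ℝ) - b • LinearMap.snd ℝ V ℝ

@[simp] theorem homogenization_apply (f : V →ₗ[ℝ] ℝ) (b : ℝ) (p : V × ℝ) :
    homogenization f b p = f p.1 - b * p.2 := by
  simp [homogenization]

/-- Linear Farkas on V × ℝ; the index `none` carries the constraint t ≥ 0, and its multiplier is the
slack in the last inequality. -/
theorem exists_nonneg_combination_homogenization (s : Finset ι) (f : ι → V →ₗ[ℝ] ℝ) (b : ι → ℝ)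
    (c : V →ₗ[ℝ] ℝ) (β : ℝ)
    (h : ∀ x t, 0 ≤ t → (∀ i ∈ s, b i * t ≤ f i x) → β * t ≤ c x) :
    ∃ l : ι → ℝ, (∀ i, 0 ≤ l i) ∧ (∀ x, c x = ∑ i ∈ s, l i * f i x) ∧
      β ≤ ∑ i ∈ s, l i * b i := by
  obtain ⟨l, hl, hc⟩ := exists_nonneg_combination (Finset.insertNone s)
    (fun i => i.elim (LinearMap.snd ℝ V ℝ) fun i => homogenization (f i) (b i))
    (homogenization c β) (by
      rintro ⟨x, t⟩ hx
      have h0 : 0 ≤ t := hx none (by simp)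
      have := h x t h0 fun i hi => by
        have := hx (some i) (by simpa using hi)
        simp only [Option.elim_some, homogenization_apply] at this
        linarith
      simp only [homogenization_apply]
      linarith)
  refine ⟨fun i => l (some i), fun i => hl _, fun x => ?_, ?_⟩
  · simpa using hc (x, 0)
  · have h1 := hc (0, 1)
    have h2 := hl none
    simp at h1
    linarith

/-- The affine form of Farkas' lemma: a consequence of a solvable finite system of inequalities
is dominated by a nonnegative combination of them. -/
theorem exists_nonneg_combination_of_feasible (s : Finset ι) (f : ι → V →ₗ[ℝ] ℝ) (b : ι → ℝ)
    (c : V →ₗ[ℝ] ℝ) (β : ℝ) (x₀ : V) (hx₀ : ∀ i ∈ s, b i ≤ f i x₀)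
    (h : ∀ x, (∀ i ∈ s, b i ≤ f i x) → β ≤ c x) :
    ∃ l : ι → ℝ, (∀ i, 0 ≤ l i) ∧ (∀ x, c x = ∑ i ∈ s, l i * f i x) ∧
      β ≤ ∑ i ∈ s, l i * b i := by
  refine exists_nonneg_combination_homogenization s f b c β fun x t ht hx => ?_
  rcases ht.eq_or_lt with rfl | ht
  · simp only [mul_zero] at hx ⊢
    by_contra hcon
    push Not at hcon
    -- Here x is a recession direction with c x < 0; the step length brings the value of c down to β
    -- - 1.
    have := h (x₀ + ((c x₀ - β + 1) / (-c x)) • x) fun i hi => by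
      have h1 : 0 ≤ (c x₀ - β + 1) / (-c x) :=
        div_nonneg (by linarith [h x₀ hx₀]) (by linarith)
      have := mul_nonneg h1 (hx i hi)
      simp only [map_add, map_smul, smul_eq_mul]
      linarith [hx₀ i hi]
    simp only [map_add, map_smul, smul_eq_mul] at this
    have h2 : (c x₀ - β + 1) / (-c x) * c x = -(c x₀ - β + 1) := by
      have : c x ≠ 0 := hcon.ne
      field_simp
    linarith
  · have := h (t⁻¹ • x) fun i hi => by
      rw [map_smul, smul_eq_mul, inv_mul_eq_div, le_div_iff₀ ht]
      exact hx i hi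
    rwa [map_smul, smul_eq_mul, inv_mul_eq_div, le_div_iff₀ ht] at this

/-- Farkas' lemma as a theorem of the alternative for a finite system of inequalities. -/
theorem exists_nonneg_combination_of_infeasible (s : Finset ι) (f : ι → V →ₗ[ℝ] ℝ) (b : ι → ℝ)
    (h : ¬ ∃ x, ∀ i ∈ s, b i ≤ f i x) :
    ∃ l : ι → ℝ, (∀ i, 0 ≤ l i) ∧ (∀ x, ∑ i ∈ s, l i * f i x = 0) ∧
      0 < ∑ i ∈ s, l i * b i := by
  obtain ⟨l, hl, hc, hb⟩ := exists_nonneg_combination_homogenization s f b 0 1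
    (fun x t ht hx => by
      rcases ht.eq_or_lt with rfl | ht
      · simp
      · refine absurd ⟨t⁻¹ • x, fun i hi => ?_⟩ h
        rw [map_smul, smul_eq_mul, inv_mul_eq_div, le_div_iff₀ ht]
        exact hx i hi)
  exact ⟨l, hl, fun x => (hc x).symm, by linarith⟩

end Farkas

/-! ### Sets generated by points and directions. -/

section Generated

variable {q : ℕ}

/-- The linear form `z ↦ c ⬝ᵥ z`. -/
noncomputable def dotForm (c : Fin q → ℝ) : (Fin q → ℝ) →ₗ[ℝ] ℝ := dotProductBilin ℝ ℝ c

@[simp] theorem dotForm_apply (c z : Fin q → ℝ) : dotForm c z = c ⬝ᵥ z := rfl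

/-- The set generated by the points and directions in `Y`. -/
def generated (Y : Set (Gen q)) : Set (Fin q → ℝ) :=
  convexHull ℝ {y | Gen.point y ∈ Y} +
    (PointedCone.hull ℝ {y | Gen.direction y ∈ Y} : Set (Fin q → ℝ))

theorem isVRep_iff {Y : Set (Gen q)} {Q : Set (Fin q → ℝ)} (hY : Y.Finite) :
    IsVRep Y Q ↔ Gen.direction 0 ∉ Y ∧ generated Y = Q := by
  simp [IsVRep, generated, hY]

theorem le_dotProduct_of_mem_generated {Y : Set (Gen q)} {c : Fin q → ℝ} {β : ℝ}
    (h : ∀ g ∈ Y, g.xi * β ≤ c ⬝ᵥ g.vec) {z : Fin q → ℝ} (hz : z ∈ generated Y) :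
    β ≤ c ⬝ᵥ z := by
  obtain ⟨p, hp, r, hr, rfl⟩ := hz
  have h1 : β ≤ c ⬝ᵥ p := by
    have : convexHull ℝ {y | Gen.point y ∈ Y} ⊆ {y | β ≤ dotForm c y} :=
      convexHull_min (fun y hy => by simpa [Gen.xi, Gen.vec] using h _ hy)
        (convex_halfSpace_ge (dotForm c).isLinear β)
    exact this hp
  have h2 : 0 ≤ c ⬝ᵥ r := by
    refine Submodule.span_induction (p := fun x _ => 0 ≤ c ⬝ᵥ x) ?_ ?_ ?_ ?_ hr
    · intro y hy
      simpa [Gen.xi, Gen.vec] using h _ hy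
    · simp
    · intro x y _ _ hx hy
      rw [dotProduct_add]
      exact add_nonneg hx hy
    · intro t x _ hx
      have : c ⬝ᵥ (t • x) = (t : ℝ) * c ⬝ᵥ x := by
        rw [← smul_eq_mul, ← dotProduct_smul]; rfl
      rw [this]
      exact mul_nonneg t.2 hx
  rw [dotProduct_add]
  linarith

theorem sum_smul_mem_generated {Y : Set (Gen q)} (s : Finset (Gen q)) (hs : ∀ g ∈ s, g ∈ Y)
    (l : Gen q → ℝ) (hl : ∀ g, 0 ≤ l g) (h1 : ∑ g ∈ s, l g * g.xi = 1) :
    ∑ g ∈ s, l g • g.vec ∈ generated Y := by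
  classical
  have hsplit : ∑ g ∈ s, l g • g.vec =
      ∑ g ∈ s.filter (fun g => g.xi = 1), l g • g.vec +
        ∑ g ∈ s.filter (fun g => ¬ g.xi = 1), l g • g.vec :=
    (Finset.sum_filter_add_sum_filter_not _ _ _).symm
  rw [hsplit]
  refine Set.add_mem_add ?_ ?_
  · refine (convex_convexHull ℝ _).sum_mem (fun g _ => hl g) ?_ fun g hg => ?_
    · rw [Finset.sum_filter]
      refine (Finset.sum_congr rfl fun g _ => ?_).trans h1
      cases g <;> simp [Gen.xi]
    · rw [Finset.mem_filter] at hg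
      refine subset_convexHull ℝ _ ?_
      cases g with
      | point y => exact hs _ hg.1
      | direction y => simp [Gen.xi] at hg
  · refine Submodule.sum_mem _ fun g hg => ?_
    rw [Finset.mem_filter] at hg
    cases g with
    | point y => simp [Gen.xi] at hg
    | direction y =>
      exact Submodule.smul_mem _ (⟨l (.direction y), hl _⟩ : NNReal)
        (PointedCone.subset_hull (hs _ hg.1))

/-- A point satisfying every inequality that is valid for the generators is generated by them. -/
theorem mem_generated {Y : Set (Gen q)} (hY : Y.Finite) {p : Fin q → ℝ}
    (h : ∀ (c : Fin q → ℝ) (β : ℝ), (∀ g ∈ Y, g.xi * β ≤ c ⬝ᵥ g.vec) → β ≤ c ⬝ᵥ p) :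
    p ∈ generated Y := by
  -- Farkas in the space of inequalities (c, β), on which every generator acts as a linear form.
  -- Evaluating at (e_j, 0) and (0, -1) then recovers the coordinates of p and the total mass on the
  -- points.
  obtain ⟨l, hl, hc⟩ := exists_nonneg_combination hY.toFinset
    (fun g => homogenization (dotForm g.vec) g.xi) (homogenization (dotForm p) 1) (by
      rintro ⟨c, β⟩ hx
      have := h c β fun g hg => by
        have := hx g (by simpa using hg)
        simp only [homogenization_apply, dotForm_apply, dotProduct_comm g.vec] at this
        linarith
      simp only [homogenization_apply, dotForm_apply, dotProduct_comm p]
      linarith)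
  have hp : p = ∑ g ∈ hY.toFinset, l g • g.vec := by
    ext j
    have := hc (Pi.single j 1, 0)
    simpa using this
  rw [hp]
  refine sum_smul_mem_generated _ (fun g hg => by simpa using hg) l hl ?_
  have := hc (0, -1)
  simpa using this.symm

end Generated
-- The coupling function as an affine function of either argument.
section Coupling

variable {d : ℕ}

/-- The weight vector `(y*_1, …, y*_{q-1}, 1 - ∑ y*_i)` of a point of the dual space. -/
noncomputable def weight (ys : Fin (d + 1) → ℝ) : Fin (d + 1) → ℝ :=
  Fin.snoc (α := fun _ => ℝ) (fun i : Fin d => ys i.castSucc) (1 - ∑ i : Fin d, ys i.castSucc)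

@[simp] theorem weight_castSucc (ys : Fin (d + 1) → ℝ) (i : Fin d) :
    weight ys i.castSucc = ys i.castSucc := by simp [weight]

@[simp] theorem weight_last (ys : Fin (d + 1) → ℝ) :
    weight ys (Fin.last d) = 1 - ∑ i : Fin d, ys i.castSucc := by simp [weight]

theorem sum_weight (ys : Fin (d + 1) → ℝ) : ∑ i, weight ys i = 1 := by
  simp [Fin.sum_univ_castSucc]

theorem weight_eq {ys c : Fin (d + 1) → ℝ} (h : ∀ i : Fin d, ys i.castSucc = c i.castSucc)
    (hc : ∑ i, c i = 1) : weight ys = c := by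
  rw [Fin.sum_univ_castSucc] at hc
  ext i
  refine Fin.lastCases ?_ (fun i => ?_) i
  · simp only [weight_last, h]
    linarith
  · simp [h]

theorem coupling_eq_weight (g : Gen (d + 1)) (ys : Fin (d + 1) → ℝ) :
    coupling g ys = weight ys ⬝ᵥ g.vec - g.xi * ys (Fin.last d) := by
  simp [coupling, dotProduct, Fin.sum_univ_castSucc, mul_comm]

/-- The linear part of the coupling function in its second argument. -/
noncomputable def slope (g : Gen (d + 1)) : Fin (d + 1) → ℝ :=
  Fin.snoc (α := fun _ => ℝ) (fun i : Fin d => g.vec i.castSucc - g.vec (Fin.last d)) (-g.xi)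

@[simp] theorem slope_castSucc (g : Gen (d + 1)) (i : Fin d) :
    slope g i.castSucc = g.vec i.castSucc - g.vec (Fin.last d) := by simp [slope]

@[simp] theorem slope_last (g : Gen (d + 1)) : slope g (Fin.last d) = -g.xi := by simp [slope]

theorem coupling_eq_slope (g : Gen (d + 1)) (ys : Fin (d + 1) → ℝ) :
    coupling g ys = slope g ⬝ᵥ ys + g.vec (Fin.last d) := by
  simp only [coupling, dotProduct, Fin.sum_univ_castSucc, slope_castSucc, slope_last, sub_mul,
    Finset.sum_sub_distrib, mul_sub, Finset.mul_sum]
  ring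

theorem isHalfspace_of_slope_ne_zero {g : Gen (d + 1)} (h : slope g ≠ 0) :
    IsHalfspace {ys | 0 ≤ coupling g ys} := by
  refine ⟨slope g, -g.vec (Fin.last d), h, ?_⟩
  ext ys
  simp only [Set.mem_ofPred_eq, coupling_eq_slope]
  constructor <;> intro h <;> linarith

theorem isHalfspace_coupling_point (ys : Fin (d + 1) → ℝ) :
    IsHalfspace {y | 0 ≤ coupling (.point y) ys} := by
  refine ⟨weight ys, ys (Fin.last d), fun h => ?_, ?_⟩
  · have := sum_weight ys
    simp [h] at this
  · ext y
    simp [coupling_eq_weight, Gen.vec, Gen.xi]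

@[simp] theorem coupling_point (y ys : Fin (d + 1) → ℝ) :
    0 ≤ coupling (.point y) ys ↔ ys (Fin.last d) ≤ weight ys ⬝ᵥ y := by
  simp [coupling_eq_weight, Gen.vec, Gen.xi]

@[simp] theorem coupling_direction (y ys : Fin (d + 1) → ℝ) :
    coupling (.direction y) ys = weight ys ⬝ᵥ y := by
  simp [coupling_eq_weight, Gen.vec, Gen.xi]

end Coupling

/-! ### Linear programming duality between the two images. -/

section Duality

variable {m n d : ℕ} {a : Fin m → EReal} {B : Matrix (Fin m) (Fin n) ℝ}
  {P : Matrix (Fin (d + 1)) (Fin n) ℝ}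

theorem sum_mul_coe {a : Fin m → EReal} (ha : ∀ i, a i ≠ ⊤) {u : Fin m → ℝ}
    (h : ∀ i, a i = ⊥ → u i = 0) :
    ∑ i, a i * ((u i : ℝ) : EReal) = ((∑ i, (a i).toReal * u i : ℝ) : EReal) := by
  rw [show ((∑ i, (a i).toReal * u i : ℝ) : EReal) = ∑ i, (((a i).toReal * u i : ℝ) : EReal) from
    map_sum (⟨⟨Real.toEReal, EReal.coe_zero⟩, EReal.coe_add⟩ : ℝ →+ EReal) _ _]
  refine Finset.sum_congr rfl fun i _ => ?_
  by_cases hi : a i = ⊥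
  · simp [h i hi]
  · rw [EReal.coe_mul, EReal.coe_toReal (ha i) hi]

theorem sum_mul_coe_eq_bot {a : Fin m → EReal} {u : Fin m → ℝ} {i : Fin m}
    (hi : a i = ⊥) (hu : 0 < u i) :
    ∑ i, a i * ((u i : ℝ) : EReal) = ⊥ := by
  rw [← Finset.add_sum_erase _ _ (Finset.mem_univ i), hi, EReal.bot_mul_coe_of_pos hu,
    EReal.bot_add]

theorem mem_feasibleSet (ha : ∀ i, a i ≠ ⊤) {x : Fin n → ℝ} :
    x ∈ feasibleSet a B ↔ ∀ i, a i ≠ ⊥ → (a i).toReal ≤ (B *ᵥ x) i := by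
  refine forall_congr' fun i => ?_
  by_cases hi : a i = ⊥
  · simp [hi]
  · rw [← EReal.coe_toReal (ha i) hi]
    simp

theorem mem_upperImage {y : Fin (d + 1) → ℝ} :
    y ∈ upperImage a B P ↔ ∃ x ∈ feasibleSet a B, P *ᵥ x ≤ y := by
  constructor
  · rintro ⟨_, ⟨x, hx, rfl⟩, r, hr, rfl⟩
    exact ⟨x, hx, by simpa using hr⟩
  · rintro ⟨x, hx, h⟩
    exact ⟨_, ⟨x, hx, rfl⟩, y - P *ᵥ x, sub_nonneg.2 h, by simp⟩

/-- This removes `EReal`: a positive u_i at an entry -∞ makes the objective -∞, so such u_i vanish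
and the value `toReal ⊥ = 0` is harmless. The cone K becomes the final inequality. -/
theorem mem_lowerImage (ha : ∀ i, a i ≠ ⊤) {ys : Fin (d + 1) → ℝ} :
    ys ∈ lowerImage a B P ↔ ∃ u : Fin m → ℝ, 0 ≤ u ∧ Bᵀ *ᵥ u = Pᵀ *ᵥ weight ys ∧
      0 ≤ weight ys ∧ (∀ i, a i = ⊥ → u i = 0) ∧
      ys (Fin.last d) ≤ ∑ i, (a i).toReal * u i := by
  constructor
  · rintro ⟨⟨u, w⟩, ⟨h1, h2, h3, h4⟩, k, ⟨hk, hk'⟩, h⟩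
    have hw : weight ys = w := by
      refine weight_eq (fun i => ?_) h4
      have := h i.castSucc
      simp only [dualObjective, Fin.snoc_castSucc, hk i] at this
      simpa using this
    have hl := h (Fin.last d)
    simp only [dualObjective, Fin.snoc_last] at hl
    have hu : ∀ i, a i = ⊥ → u i = 0 := by
      intro i hi
      by_contra hne
      rw [sum_mul_coe_eq_bot hi (lt_of_le_of_ne (h2 i) (Ne.symm hne))] at hl
      simp at hl
    rw [sum_mul_coe ha hu, ← EReal.coe_sub, EReal.coe_eq_coe_iff] at hl
    exact ⟨u, h2, by rw [hw]; exact h1, by rw [hw]; exact h3, hu, by linarith⟩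
  · rintro ⟨u, hu, h1, h2, h3, h4⟩
    refine ⟨(u, weight ys), ⟨h1, hu, h2, sum_weight ys⟩,
      Pi.single (Fin.last d) (∑ i, (a i).toReal * u i - ys (Fin.last d)), ⟨fun i => ?_, ?_⟩,
      fun i => ?_⟩
    · simp [(Fin.castSucc_lt_last i).ne]
    · simpa using h4
    · refine Fin.lastCases ?_ (fun i => ?_) i
      · simp only [dualObjective, Fin.snoc_last, sum_mul_coe ha h3, Pi.single_eq_same]
        rw [← EReal.coe_sub, EReal.coe_eq_coe_iff]
        ring
      · simp [dualObjective, (Fin.castSucc_lt_last i).ne]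

/-- Weak duality. -/
theorem le_weight_dotProduct (ha : ∀ i, a i ≠ ⊤) {y ys : Fin (d + 1) → ℝ}
    (hy : y ∈ upperImage a B P) (hys : ys ∈ lowerImage a B P) :
    ys (Fin.last d) ≤ weight ys ⬝ᵥ y := by
  obtain ⟨x, hx, hxy⟩ := mem_upperImage.1 hy
  obtain ⟨u, hu, h1, h2, h3, h4⟩ := (mem_lowerImage ha).1 hys
  rw [mem_feasibleSet ha] at hx
  calc ys (Fin.last d) ≤ ∑ i, (a i).toReal * u i := h4
    _ ≤ u ⬝ᵥ (B *ᵥ x) := by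
      refine Finset.sum_le_sum fun i _ => ?_
      by_cases hi : a i = ⊥
      · simp [h3 i hi]
      · rw [mul_comm]
        exact mul_le_mul_of_nonneg_left (hx i hi) (hu i)
    _ = weight ys ⬝ᵥ (P *ᵥ x) := by
      rw [Matrix.dotProduct_mulVec, Matrix.dotProduct_mulVec, ← Matrix.mulVec_transpose, h1,
        Matrix.mulVec_transpose]
    _ ≤ weight ys ⬝ᵥ y := Finset.sum_le_sum fun i _ => mul_le_mul_of_nonneg_left (hxy i) (h2 i)

theorem add_nonneg_mem_upperImage {y r : Fin (d + 1) → ℝ} (hy : y ∈ upperImage a B P)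
    (hr : 0 ≤ r) : y + r ∈ upperImage a B P := by
  obtain ⟨x, hx, hxy⟩ := mem_upperImage.1 hy
  exact mem_upperImage.2 ⟨x, hx, hxy.trans (le_add_of_nonneg_right hr)⟩

/-- The linear form `x ↦ (M x)_i`. -/
noncomputable def rowForm {k : ℕ} (M : Matrix (Fin k) (Fin n) ℝ) (i : Fin k) :
    (Fin n → ℝ) →ₗ[ℝ] ℝ := (LinearMap.proj i).comp M.mulVecLin

@[simp] theorem rowForm_apply {k : ℕ} (M : Matrix (Fin k) (Fin n) ℝ) (i : Fin k) (x : Fin n → ℝ) :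
    rowForm M i x = (M *ᵥ x) i := rfl

/-- An affine function that is bounded below on a ray has nonnegative slope. -/
theorem nonneg_of_forall_le_add_mul {β b r : ℝ} (h : ∀ t : ℝ, 0 ≤ t → β ≤ b + t * r) : 0 ≤ r := by
  by_contra hr
  push Not at hr
  have h0 : β ≤ b := by simpa using h 0 le_rfl
  have := h ((b - β + 1) / (-r)) (div_nonneg (by linarith) (by linarith))
  have h2 : (b - β + 1) / (-r) * r = -(b - β + 1) := by
    have : r ≠ 0 := hr.ne
    field_simp
  linarith

/-- Strong duality: Farkas multipliers for w ⬝ᵥ P x ≥ y*_q on the feasible set form the dual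
solution u. Nonnegativity of w comes from the upper image being closed under adding ℝ^q_+. -/
theorem mem_lowerImage_of_forall (ha : ∀ i, a i ≠ ⊤) (hne : (upperImage a B P).Nonempty)
    {ys : Fin (d + 1) → ℝ}
    (h : ∀ y ∈ upperImage a B P, ys (Fin.last d) ≤ weight ys ⬝ᵥ y) : ys ∈ lowerImage a B P := by
  classical
  obtain ⟨y₀, hy₀⟩ := hne
  obtain ⟨x₀, hx₀, -⟩ := mem_upperImage.1 hy₀
  have hw : 0 ≤ weight ys := fun i => by
    refine nonneg_of_forall_le_add_mul (β := ys (Fin.last d)) (b := weight ys ⬝ᵥ y₀) fun t ht => ?_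
    have := h _ (add_nonneg_mem_upperImage hy₀ (r := Pi.single i t) (by
      simpa using ht))
    rw [dotProduct_add, dotProduct_single] at this
    linarith
  have hfeas : ∀ x : Fin n → ℝ, x ∈ feasibleSet a B ↔
      ∀ i ∈ Finset.univ.filter (fun i => a i ≠ ⊥), (a i).toReal ≤ rowForm B i x := fun x => by
    simp [mem_feasibleSet ha]
  obtain ⟨l, hl, hc, hb⟩ := exists_nonneg_combination_of_feasible
    (Finset.univ.filter fun i => a i ≠ ⊥) (rowForm B) (fun i => (a i).toReal)
    ((dotForm (weight ys)).comp P.mulVecLin) (ys (Fin.last d)) x₀ ((hfeas _).1 hx₀)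
    (fun x hx => h _ (mem_upperImage.2 ⟨x, (hfeas x).2 hx, le_rfl⟩))
  refine (mem_lowerImage ha).2 ⟨fun i => if a i = ⊥ then 0 else l i, fun i => ?_, ?_, hw,
    fun i hi => by simp [hi], ?_⟩
  · by_cases hi : a i = ⊥ <;> simp [hi, hl i]
  · ext j
    have := hc (Pi.single j 1)
    simp [Finset.sum_filter] at this
    rw [Matrix.mulVec_transpose, Matrix.mulVec_transpose]
    simp only [Matrix.vecMul]
    change _ = weight ys ⬝ᵥ P.col j
    rw [this]
    refine Finset.sum_congr rfl fun i _ => ?_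
    by_cases hi : a i = ⊥ <;> simp [hi]
  · refine hb.trans_eq ?_
    rw [Finset.sum_filter]
    refine Finset.sum_congr rfl fun i _ => ?_
    by_cases hi : a i = ⊥ <;> simp [hi, mul_comm]

/-- If y is outside, the system B x ≥ a, P x ≤ y is infeasible, and its Farkas certificate (u, w)
gives a dual point violated by y. -/
theorem mem_upperImage_of_forall (ha : ∀ i, a i ≠ ⊤) (hne : (upperImage a B P).Nonempty)
    {y : Fin (d + 1) → ℝ}
    (h : ∀ ys ∈ lowerImage a B P, ys (Fin.last d) ≤ weight ys ⬝ᵥ y) : y ∈ upperImage a B P := by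
  classical
  obtain ⟨y₀, hy₀⟩ := hne
  obtain ⟨x₀, hx₀, -⟩ := mem_upperImage.1 hy₀
  by_contra hy
  obtain ⟨l, hl, hc, hb⟩ := exists_nonneg_combination_of_infeasible
    ((Finset.univ.filter fun i => a i ≠ ⊥).disjSum (Finset.univ : Finset (Fin (d + 1))))
    (Sum.elim (rowForm B) fun j => -rowForm P j)
    (Sum.elim (fun i => (a i).toReal) fun j => -y j) (by
      rintro ⟨x, hx⟩
      refine hy (mem_upperImage.2 ⟨x, (mem_feasibleSet ha).2 fun i hi => ?_, fun j => ?_⟩)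
      · simpa using hx (.inl i) (by simpa using hi)
      · simpa using hx (.inr j) (by simp))
  simp only [Finset.sum_disjSum, Sum.elim_inl, Sum.elim_inr, Finset.sum_filter,
    LinearMap.neg_apply, rowForm_apply, mul_neg, Finset.sum_neg_distrib] at hc hb
  set u : Fin m → ℝ := fun i => if a i = ⊥ then 0 else l (.inl i) with hu
  set w : Fin (d + 1) → ℝ := fun j => l (.inr j) with hw
  have hu0 : 0 ≤ u := fun i => by by_cases hi : a i = ⊥ <;> simp [hu, hi, hl]
  have hw0 : 0 ≤ w := fun j => hl _
  have hub : ∀ i, a i = ⊥ → u i = 0 := fun i hi => by simp [hu, hi]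
  have hc' : ∀ x, u ⬝ᵥ (B *ᵥ x) = w ⬝ᵥ (P *ᵥ x) := fun x => by
    rw [← sub_eq_zero, sub_eq_add_neg, ← hc x]
    congr 1
    refine Finset.sum_congr rfl fun i _ => ?_
    by_cases hi : a i = ⊥ <;> simp [hu, hi]
  have hb' : w ⬝ᵥ y < ∑ i, (a i).toReal * u i := by
    have : ∑ i, (a i).toReal * u i = ∑ i, if a i ≠ ⊥ then l (.inl i) * (a i).toReal else 0 := by
      refine Finset.sum_congr rfl fun i _ => ?_
      by_cases hi : a i = ⊥ <;> simp [hu, hi, mul_comm]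
    rw [this, ← sub_pos, sub_eq_add_neg]
    exact hb
  -- If w = 0, the certificate would contradict feasibility of `x₀`; otherwise dividing by ∑ w_j
  -- makes it dual feasible.
  rcases (Finset.sum_nonneg fun j (_ : j ∈ Finset.univ) => hw0 j).eq_or_lt with hs | hs
  · have hwz : w = 0 := by
      ext j
      exact (Finset.sum_eq_zero_iff_of_nonneg fun j _ => hw0 j).1 hs.symm j (Finset.mem_univ j)
    have h1 := hc' x₀
    rw [hwz, zero_dotProduct] at h1 hb'
    have h2 : ∑ i, (a i).toReal * u i ≤ u ⬝ᵥ (B *ᵥ x₀) := by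
      refine Finset.sum_le_sum fun i _ => ?_
      by_cases hi : a i = ⊥
      · simp [hub i hi]
      · rw [mul_comm]
        exact mul_le_mul_of_nonneg_left ((mem_feasibleSet ha).1 hx₀ i hi) (hu0 i)
    linarith
  · set σ : ℝ := ∑ j, w j with hσ
    have hσi : 0 < σ⁻¹ := inv_pos.2 hs
    have hwt : weight (Fin.snoc (α := fun _ => ℝ) (fun i : Fin d => (σ⁻¹ • w) i.castSucc)
        (σ⁻¹ * ∑ i, (a i).toReal * u i)) = σ⁻¹ • w := by
      refine weight_eq (fun i => by simp) ?_
      simp only [Pi.smul_apply, smul_eq_mul, ← Finset.mul_sum]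
      exact inv_mul_cancel₀ hs.ne'
    have := h (Fin.snoc (α := fun _ => ℝ) (fun i : Fin d => (σ⁻¹ • w) i.castSucc)
        (σ⁻¹ * ∑ i, (a i).toReal * u i)) ((mem_lowerImage ha).2
      ⟨σ⁻¹ • u, smul_nonneg hσi.le hu0, ?_, ?_, fun i hi => by simp [hub i hi], ?_⟩)
    · rw [hwt, Fin.snoc_last, smul_dotProduct, smul_eq_mul] at this
      exact absurd (le_of_mul_le_mul_left this hσi) (not_le.2 hb')
    · rw [hwt, Matrix.mulVec_smul, Matrix.mulVec_smul]
      congr 1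
      ext j
      rw [Matrix.mulVec_transpose, Matrix.mulVec_transpose]
      have : u ⬝ᵥ B.col j = w ⬝ᵥ P.col j := by simpa using hc' (Pi.single j 1)
      exact this
    · rw [hwt]
      exact smul_nonneg hσi.le hw0
    · rw [Fin.snoc_last, Finset.mul_sum]
      exact (Finset.sum_congr rfl fun i _ => by simp; ring).le

end Duality
-- From representations of one image to representations of the other.
section GeometricDuality

variable {m n d : ℕ} {a : Fin m → EReal} {B : Matrix (Fin m) (Fin n) ℝ}
  {P : Matrix (Fin (d + 1)) (Fin n) ℝ}

theorem mem_lowerImage_iff (ha : ∀ i, a i ≠ ⊤) (hne : (upperImage a B P).Nonempty)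
    {ys : Fin (d + 1) → ℝ} :
    ys ∈ lowerImage a B P ↔ ∀ y ∈ upperImage a B P, 0 ≤ coupling (.point y) ys := by
  simp only [coupling_point]
  exact ⟨fun h y hy => le_weight_dotProduct ha hy h, mem_lowerImage_of_forall ha hne⟩

theorem mem_upperImage_iff (ha : ∀ i, a i ≠ ⊤) (hne : (upperImage a B P).Nonempty)
    {y : Fin (d + 1) → ℝ} :
    y ∈ upperImage a B P ↔ ∀ ys ∈ lowerImage a B P, 0 ≤ coupling (.point y) ys := by
  simp only [coupling_point]
  exact ⟨fun h ys hys => le_weight_dotProduct ha h hys, mem_upperImage_of_forall ha hne⟩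

theorem coupling_point_nonneg_of_mem_generated {Y : Set (Gen (d + 1))} {ys y : Fin (d + 1) → ℝ}
    (h : ∀ g ∈ Y, 0 ≤ coupling g ys) (hy : y ∈ generated Y) : 0 ≤ coupling (.point y) ys := by
  rw [coupling_point]
  refine le_dotProduct_of_mem_generated (fun g hg => ?_) hy
  have := h g hg
  rw [coupling_eq_weight] at this
  linarith

theorem weight_nonneg (ha : ∀ i, a i ≠ ⊤) {ys : Fin (d + 1) → ℝ}
    (hys : ys ∈ lowerImage a B P) : 0 ≤ weight ys := by
  obtain ⟨u, -, -, hw, -⟩ := (mem_lowerImage ha).1 hys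
  exact hw

theorem point_mem_generated {q : ℕ} {Y : Set (Gen q)} {y : Fin q → ℝ} (h : Gen.point y ∈ Y) :
    y ∈ generated Y :=
  ⟨y, subset_convexHull ℝ _ h, 0, Submodule.zero_mem _, add_zero y⟩

theorem add_smul_mem_generated {q : ℕ} {Y : Set (Gen q)} {y r : Fin q → ℝ} {t : ℝ}
    (hy : y ∈ generated Y) (hr : Gen.direction r ∈ Y) (ht : 0 ≤ t) : y + t • r ∈ generated Y := by
  obtain ⟨p, hp, z, hz, rfl⟩ := hy
  refine ⟨p, hp, z + t • r, Submodule.add_mem _ hz ?_, (add_assoc _ _ _).symm⟩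
  exact Submodule.smul_mem _ (⟨t, ht⟩ : NNReal) (PointedCone.subset_hull hr)

/-- Points of the lower image satisfy the inequalities given by generators of the upper image. -/
theorem coupling_nonneg_of_generated_eq (ha : ∀ i, a i ≠ ⊤) (hne : (upperImage a B P).Nonempty)
    {Y : Set (Gen (d + 1))} (hY : generated Y = upperImage a B P) {ys : Fin (d + 1) → ℝ}
    (hys : ys ∈ lowerImage a B P) {g : Gen (d + 1)} (hg : g ∈ Y) : 0 ≤ coupling g ys := by
  cases g with
  | point y => exact (mem_lowerImage_iff ha hne).1 hys y (hY ▸ point_mem_generated hg)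
  | direction r =>
    obtain ⟨y₀, hy₀⟩ := hne
    rw [coupling_direction]
    refine nonneg_of_forall_le_add_mul (β := ys (Fin.last d)) (b := weight ys ⬝ᵥ y₀) fun t ht => ?_
    have := le_weight_dotProduct ha (hY ▸ add_smul_mem_generated (hY.symm ▸ hy₀) hg ht) hys
    rwa [dotProduct_add, dotProduct_smul, smul_eq_mul] at this

/-- With no dual point there is no constraint on y, so the upper image would be all of ℝ^q, which
has no vertex. -/
theorem lowerImage_nonempty (ha : ∀ i, a i ≠ ⊤)
    (hv : (Set.extremePoints ℝ (upperImage a B P)).Nonempty) : (lowerImage a B P).Nonempty := by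
  obtain ⟨v, hv, hext⟩ := hv
  by_contra hemp
  rw [Set.not_nonempty_iff_eq_empty] at hemp
  have hall : ∀ y, y ∈ upperImage a B P := fun y =>
    (mem_upperImage_iff ha ⟨v, hv⟩).2 (by simp [hemp])
  have := hext (hall (v - 1)) (hall (v + 1)) ⟨1 / 2, 1 / 2, by norm_num, by norm_num, by norm_num,
    by ext i; simp; ring⟩
  have := congrFun this 0
  simp at this

/-- If the upper image has a vertex, the weights occurring in the lower image are not unique. -/
theorem exists_weight_ne (ha : ∀ i, a i ≠ ⊤) (hd : 1 ≤ d)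
    (hv : (Set.extremePoints ℝ (upperImage a B P)).Nonempty) (w : Fin (d + 1) → ℝ) :
    ∃ ys ∈ lowerImage a B P, weight ys ≠ w := by
  obtain ⟨v, hv, hext⟩ := hv
  by_contra! hcon
  -- Since q ≥ 2, some nonzero r is orthogonal to w. If w were the only weight, the whole line
  -- through v in direction r would lie in the upper image.
  obtain ⟨r, hr, hwr⟩ : ∃ r : Fin (d + 1) → ℝ, r ≠ 0 ∧ w ⬝ᵥ r = 0 := by
    have h0l : (0 : Fin (d + 1)) ≠ Fin.last d := by
      intro h
      have := congrArg Fin.val h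
      simp at this
      omega
    by_cases hw : w 0 = 0
    · exact ⟨Pi.single 0 1, by simp, by simp [hw]⟩
    · refine ⟨Pi.single 0 (w (Fin.last d)) - Pi.single (Fin.last d) (w 0), fun h => hw ?_, ?_⟩
      · have := congrFun h (Fin.last d)
        simpa [h0l.symm] using this
      · simp [dotProduct_sub, mul_comm]
  have hmem : ∀ t : ℝ, v + t • r ∈ upperImage a B P := fun t => by
    refine (mem_upperImage_iff ha ⟨v, hv⟩).2 fun ys hys => ?_
    rw [coupling_point, dotProduct_add, dotProduct_smul, hcon ys hys, hwr, smul_zero, add_zero,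
      ← hcon ys hys]
    exact le_weight_dotProduct ha hv hys
  have := hext (hmem (-1)) (hmem 1) ⟨1 / 2, 1 / 2, by norm_num, by norm_num, by norm_num,
    by ext i; simp; ring⟩
  simp at this
  exact hr this

theorem exists_weight_eq (c : Fin (d + 1) → ℝ) (hc : ∑ i, c i = 1) (β : ℝ) :
    ∃ ys : Fin (d + 1) → ℝ, weight ys = c ∧ ys (Fin.last d) = β :=
  ⟨Fin.snoc (α := fun _ => ℝ) (fun i : Fin d => c i.castSucc) β,
    weight_eq (fun i => by simp) hc, by simp⟩

/-- For pointed upper images in dimension at least two, generating the upper image is the same as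
describing the lower image by inequalities. -/
theorem generated_eq_upperImage_iff (ha : ∀ i, a i ≠ ⊤) (hd : 1 ≤ d)
    (hv : (Set.extremePoints ℝ (upperImage a B P)).Nonempty) {Y : Set (Gen (d + 1))}
    (hY : Y.Finite) :
    generated Y = upperImage a B P ↔ {ys | ∀ g ∈ Y, 0 ≤ coupling g ys} = lowerImage a B P := by
  have hne : (upperImage a B P).Nonempty := hv.mono fun _ h => h.1
  constructor
  · intro h
    ext ys
    refine ⟨fun hys => (mem_lowerImage_iff ha hne).2 fun y hy => ?_,
      fun hys g hg => coupling_nonneg_of_generated_eq ha hne h hys hg⟩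
    exact coupling_point_nonneg_of_mem_generated hys (h.symm ▸ hy)
  · intro h
    have hsol : ∀ ys, (∀ g ∈ Y, 0 ≤ coupling g ys) ↔ ys ∈ lowerImage a B P :=
      fun ys => Set.ext_iff.1 h ys
    refine Set.Subset.antisymm (fun y hy => (mem_upperImage_iff ha hne).2 fun ys hys =>
      coupling_point_nonneg_of_mem_generated ((hsol ys).2 hys) hy) fun p hp => ?_
    refine mem_generated hY fun c β hc => ?_
    by_contra hcp
    push Not at hcp
    -- The pair (c, β) satisfies the homogeneous inequalities of Y, so it may be added to a dual
    -- point; the result is again a dual point once its weights sum to 1.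
    have hshift : ∀ (k t : ℝ) (ys : Fin (d + 1) → ℝ), ys ∈ lowerImage a B P → 0 ≤ k → 0 ≤ t →
        k + t * ∑ i, c i = 1 →
        ∃ zs ∈ lowerImage a B P, weight zs = k • weight ys + t • c ∧
          zs (Fin.last d) = k * ys (Fin.last d) + t * β := by
      intro k t ys hys hk ht hkt
      obtain ⟨zs, h1, h2⟩ := exists_weight_eq (k • weight ys + t • c) (by
        simp [Finset.sum_add_distrib, ← Finset.mul_sum, sum_weight, hkt])
        (k * ys (Fin.last d) + t * β)
      refine ⟨zs, (hsol zs).1 fun g hg => ?_, h1, h2⟩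
      have h3 := (hsol ys).2 hys g hg
      rw [coupling_eq_weight] at h3 ⊢
      rw [h1, h2, add_dotProduct, smul_dotProduct, smul_dotProduct, smul_eq_mul, smul_eq_mul]
      have h4 := mul_nonneg hk h3
      have h5 := mul_nonneg ht (sub_nonneg.2 (hc g hg))
      linarith
    obtain ⟨y₀, hy₀⟩ := lowerImage_nonempty ha hv
    rcases lt_or_ge 0 (∑ i, c i) with hs | hs
    · obtain ⟨zs, hzs, h1, h2⟩ := hshift 0 (∑ i, c i)⁻¹ y₀ hy₀ le_rfl (inv_pos.2 hs).le (by
        rw [inv_mul_cancel₀ hs.ne', zero_add])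
      have := le_weight_dotProduct ha hp hzs
      rw [h1, h2] at this
      simp only [zero_smul, zero_add, zero_mul, smul_dotProduct, smul_eq_mul] at this
      exact absurd (le_of_mul_le_mul_left this (inv_pos.2 hs)) (not_le.2 hcp)
    · set σ : ℝ := ∑ i, c i with hσ
      -- Weights stay nonnegative along `weight ys + t • (c - σ • weight ys)` for all t ≥ 0. The
      -- bracket is therefore nonnegative, and its sum is zero.
      have hc_eq : ∀ ys ∈ lowerImage a B P, c = σ • weight ys := by
        intro ys hys
        have hnn : ∀ i, 0 ≤ c i - σ * weight ys i := fun i => by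
          refine nonneg_of_forall_le_add_mul (β := 0) (b := weight ys i) fun t ht => ?_
          obtain ⟨zs, hzs, h1, -⟩ := hshift (1 - t * σ) t ys hys
            (by linarith [mul_nonpos_of_nonneg_of_nonpos ht hs]) ht (by ring)
          have := weight_nonneg ha hzs i
          rw [h1] at this
          simp only [Pi.add_apply, Pi.smul_apply, smul_eq_mul, Pi.zero_apply] at this
          linarith
        have hz : ∑ i, (c i - σ * weight ys i) = 0 := by
          rw [Finset.sum_sub_distrib, ← Finset.mul_sum, sum_weight, mul_one, sub_self]
        ext i
        have := (Finset.sum_eq_zero_iff_of_nonneg fun i _ => hnn i).1 hz i (Finset.mem_univ i)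
        simpa [sub_eq_zero] using this
      rcases hs.eq_or_lt with hs0 | hs0
      · have hc0 : c = 0 := by rw [hc_eq y₀ hy₀, hs0, zero_smul]
        rw [hc0, zero_dotProduct] at hcp
        -- Now c = 0 and β > 0: dual points could be raised without limit, against weak duality at
        -- p.
        have : 0 ≤ -β := by
          refine nonneg_of_forall_le_add_mul (β := 0)
            (b := weight y₀ ⬝ᵥ p - y₀ (Fin.last d)) fun t ht => ?_
          obtain ⟨zs, hzs, h1, h2⟩ := hshift 1 t y₀ hy₀ zero_le_one ht (by rw [hs0]; ring)
          have := le_weight_dotProduct ha hp hzs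
          rw [h1, h2, hc0] at this
          simp only [one_smul, smul_zero, add_zero, one_mul] at this
          linarith
        linarith
      · obtain ⟨ys, hys, hne'⟩ := exists_weight_ne ha hd hv (weight y₀)
        refine hne' (smul_right_injective _ hs0.ne ?_)
        change σ • weight ys = σ • weight y₀
        rw [← hc_eq ys hys, ← hc_eq y₀ hy₀]

/-! ### Representations of the lower image with the downward direction. -/

@[simp] theorem downDirection_castSucc (i : Fin d) : downDirection d i.castSucc = 0 := by
  simp [downDirection, (Fin.castSucc_lt_last i).ne]

@[simp] theorem downDirection_last : downDirection d (Fin.last d) = -1 := by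
  simp [downDirection]

theorem dotProduct_downDirection (c : Fin (d + 1) → ℝ) :
    c ⬝ᵥ downDirection d = -c (Fin.last d) := by
  simp [downDirection]

/-- The points of `W` together with the downward direction. -/
abbrev withDown (W : Set (Fin (d + 1) → ℝ)) : Set (Gen (d + 1)) :=
  Gen.point '' W ∪ {Gen.direction (downDirection d)}

theorem coupling_nonneg_of_mem_generated_withDown {W : Set (Fin (d + 1) → ℝ)}
    {y ys : Fin (d + 1) → ℝ} (h : ∀ w ∈ W, 0 ≤ coupling (.point y) w)
    (hys : ys ∈ generated (withDown W)) : 0 ≤ coupling (.point y) ys := by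
  have := le_dotProduct_of_mem_generated (c := slope (.point y)) (β := -y (Fin.last d))
    (fun g hg => ?_) hys
  · rw [coupling_eq_slope]
    change 0 ≤ _ + y (Fin.last d)
    linarith
  · rcases hg with ⟨w, hw, rfl⟩ | rfl
    · have := h w hw
      rw [coupling_eq_slope] at this
      simp only [Gen.vec, Gen.xi] at this ⊢
      linarith
    · simp [Gen.vec, Gen.xi, dotProduct_downDirection]

theorem generated_withDown_eq_lowerImage_iff (ha : ∀ i, a i ≠ ⊤)
    (hne : (upperImage a B P).Nonempty) {W : Set (Fin (d + 1) → ℝ)} (hW : W.Finite) :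
    generated (withDown W) = lowerImage a B P ↔
      {y | ∀ w ∈ W, 0 ≤ coupling (.point y) w} = upperImage a B P := by
  classical
  constructor
  · intro h
    ext y
    refine ⟨fun hy => (mem_upperImage_iff ha hne).2 fun ys hys =>
      coupling_nonneg_of_mem_generated_withDown hy (h.symm ▸ hys), fun hy w hw => ?_⟩
    exact (mem_upperImage_iff ha hne).1 hy w (h ▸ point_mem_generated (.inl ⟨w, hw, rfl⟩))
  · intro h
    have hsol : ∀ y, (∀ w ∈ W, 0 ≤ coupling (.point y) w) ↔ y ∈ upperImage a B P :=
      fun y => Set.ext_iff.1 h y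
    refine Set.Subset.antisymm (fun ys hys => (mem_lowerImage_iff ha hne).2 fun y hy =>
      coupling_nonneg_of_mem_generated_withDown ((hsol y).2 hy) hys) fun ys hys => ?_
    obtain ⟨y₀, hy₀⟩ := hne
    have hsys : ∀ y, (∀ w ∈ hW.toFinset, w (Fin.last d) ≤ dotForm (weight w) y) ↔
        y ∈ upperImage a B P := fun y => by simp [← hsol]
    -- All weight vectors have sum 1, so the multipliers do too. Thus `ys` lies below a convex
    -- combination of W, and the gap is filled by the downward direction.
    obtain ⟨l, hl, hc, hb⟩ := exists_nonneg_combination_of_feasible hW.toFinset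
      (fun w => dotForm (weight w)) (fun w => w (Fin.last d)) (dotForm (weight ys))
      (ys (Fin.last d)) y₀ ((hsys _).2 hy₀)
      (fun y hy => le_weight_dotProduct ha ((hsys y).1 hy) hys)
    have hweight : ∀ i, weight ys i = ∑ w ∈ hW.toFinset, l w * weight w i := fun i => by
      simpa using hc (Pi.single i 1)
    have hsum : ∑ w ∈ hW.toFinset, l w = 1 := by
      have h1 := sum_weight ys
      simp only [hweight] at h1
      rw [Finset.sum_comm] at h1
      simpa [← Finset.mul_sum, sum_weight] using h1
    have hpt : ∑ w ∈ hW.toFinset, l w • w ∈ generated (withDown W) := by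
      refine ⟨_, (convex_convexHull ℝ _).sum_mem (fun w _ => hl w) hsum fun w hw =>
        subset_convexHull ℝ _ ?_, 0, Submodule.zero_mem _, add_zero _⟩
      exact .inl ⟨w, by simpa using hw, rfl⟩
    have heq : ys = ∑ w ∈ hW.toFinset, l w • w +
        (∑ w ∈ hW.toFinset, l w * w (Fin.last d) - ys (Fin.last d)) • downDirection d := by
      ext i
      refine Fin.lastCases ?_ (fun i => ?_) i
      · simp
      · simpa using hweight i.castSucc
    rw [heq]
    exact add_smul_mem_generated hpt (.inr rfl) (sub_nonneg.2 hb)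

/-- The lower image is unbounded below, so finitely many points do not generate it. -/
theorem generated_image_point_ne_lowerImage (ha : ∀ i, a i ≠ ⊤)
    (hne : (lowerImage a B P).Nonempty) {W : Set (Fin (d + 1) → ℝ)} (hW : W.Finite) :
    generated (Gen.point '' W) ≠ lowerImage a B P := by
  intro h
  obtain ⟨M, hM⟩ := (hW.image fun w => w (Fin.last d)).bddBelow
  obtain ⟨ys, hys⟩ := hne
  obtain ⟨zs, h1, h2⟩ := exists_weight_eq (weight ys) (sum_weight ys)
    (min (ys (Fin.last d)) (M - 1))
  have hzs : zs ∈ lowerImage a B P := by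
    rw [mem_lowerImage ha] at hys ⊢
    obtain ⟨u, h3, h4, h5, h6, h7⟩ := hys
    rw [h1, h2]
    exact ⟨u, h3, h4, h5, h6, (min_le_left _ _).trans h7⟩
  rw [← h] at hzs
  have := le_dotProduct_of_mem_generated (c := Pi.single (Fin.last d) 1) (β := M) (by
    rintro _ ⟨w, hw, rfl⟩
    simpa [Gen.vec, Gen.xi] using hM ⟨w, hw, rfl⟩) hzs
  rw [single_dotProduct, one_mul, h2] at this
  linarith [min_le_right (ys (Fin.last d)) (M - 1)]

theorem direction_zero_notMem_withDown {W : Set (Fin (d + 1) → ℝ)} :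
    Gen.direction 0 ∉ withDown W := by
  rintro (⟨w, -, h⟩ | h)
  · cases h
  · have := congrFun (Gen.direction.inj h) (Fin.last d)
    simp at this

theorem isVRep_withDown_iff (ha : ∀ i, a i ≠ ⊤) (hne : (upperImage a B P).Nonempty)
    {W : Set (Fin (d + 1) → ℝ)} (hW : W.Finite) :
    IsVRep (withDown W) (lowerImage a B P) ↔
      IsHRep W (fun ys y => coupling (.point y) ys) (upperImage a B P) := by
  rw [isVRep_iff ((hW.image _).union (Set.finite_singleton _)),
    generated_withDown_eq_lowerImage_iff ha hne hW]
  simp only [direction_zero_notMem_withDown, not_false_eq_true, true_and, IsHRep, hW]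
  exact (and_iff_right fun ys _ => isHalfspace_coupling_point ys).symm

theorem isIrredundantVRep_withDown_iff (ha : ∀ i, a i ≠ ⊤) (hne : (upperImage a B P).Nonempty)
    (hne' : (lowerImage a B P).Nonempty) {W : Set (Fin (d + 1) → ℝ)} (hW : W.Finite) :
    IsIrredundantVRep (withDown W) (lowerImage a B P) ↔
      IsIrredundantHRep W (fun ys y => coupling (.point y) ys) (upperImage a B P) := by
  have hdiff : ∀ w, withDown W \ {.point w} = withDown (W \ {w}) := fun w => by
    ext g
    cases g <;> simp [withDown]
  have hdown : withDown W \ {.direction (downDirection d)} = Gen.point '' W := by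
    ext g
    cases g <;> simp [withDown]
  refine and_congr (isVRep_withDown_iff ha hne hW) ⟨fun h w hw => ?_, fun h g hg => ?_⟩
  · rw [← isVRep_withDown_iff ha hne (hW.subset Set.sdiff_subset), ← hdiff]
    exact h _ (.inl ⟨w, hw, rfl⟩)
  · rcases hg with ⟨w, hw, rfl⟩ | rfl
    · rw [hdiff, isVRep_withDown_iff ha hne (hW.subset Set.sdiff_subset)]
      exact h w hw
    · rw [hdown, isVRep_iff (hW.image _)]
      exact fun h => generated_image_point_ne_lowerImage ha hne' hW h.2

/-! ### Irredundant representations of the upper image. -/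

/-- In an irredundant V-representation of the upper image, every element gives a nonconstant
inequality. -/
theorem slope_ne_zero_of_isIrredundantVRep (ha : ∀ i, a i ≠ ⊤) (hd : 1 ≤ d)
    (hv : (Set.extremePoints ℝ (upperImage a B P)).Nonempty) {Y : Set (Gen (d + 1))}
    (h : IsIrredundantVRep Y (upperImage a B P)) {g : Gen (d + 1)} (hg : g ∈ Y) :
    slope g ≠ 0 := by
  intro h0
  -- A constant inequality that holds at one dual point holds everywhere, so g could be left out.
  obtain ⟨⟨hfin, hdir, hgen⟩, hirr⟩ := h
  refine hirr g hg ((isVRep_iff (hfin.subset Set.sdiff_subset)).2 ⟨fun h => hdir h.1, ?_⟩)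
  have hsol := (generated_eq_upperImage_iff ha hd hv hfin).1 hgen
  rw [generated_eq_upperImage_iff ha hd hv (hfin.subset Set.sdiff_subset), ← hsol]
  obtain ⟨ys, hys⟩ := lowerImage_nonempty ha hv
  have hpos : 0 ≤ g.vec (Fin.last d) := by
    rw [← hsol] at hys
    simpa [coupling_eq_slope, h0] using hys g hg
  ext zs
  refine ⟨fun hzs k hk => ?_, fun hzs k hk => hzs k hk.1⟩
  by_cases hkg : k = g
  · rw [hkg, coupling_eq_slope, h0, zero_dotProduct, zero_add]
    exact hpos
  · exact hzs k ⟨hk, hkg⟩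

/-- The zero direction cannot occur: its inequality 0 ≤ 0 is solved by the whole space, which is not
a half-space. -/
theorem isVRep_of_isHRep (ha : ∀ i, a i ≠ ⊤) (hd : 1 ≤ d)
    (hv : (Set.extremePoints ℝ (upperImage a B P)).Nonempty) {Y : Set (Gen (d + 1))}
    (h : IsHRep Y (fun y ys => coupling y ys) (lowerImage a B P)) :
    IsVRep Y (upperImage a B P) := by
  obtain ⟨hfin, hhalf, hsol⟩ := h
  refine (isVRep_iff hfin).2 ⟨fun h0 => ?_, (generated_eq_upperImage_iff ha hd hv hfin).2 hsol⟩
  obtain ⟨c, β, hc, heq⟩ := hhalf _ h0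
  have hcc : 0 < c ⬝ᵥ c := by
    obtain ⟨i, hi⟩ := Function.ne_iff.1 hc
    exact Finset.sum_pos' (fun i _ => mul_self_nonneg (c i))
      ⟨i, Finset.mem_univ i, mul_self_pos.2 hi⟩
  have := (Set.ext_iff.1 heq (((β - 1) / (c ⬝ᵥ c)) • c)).1 (by simp)
  rw [Set.mem_ofPred_eq, dotProduct_smul, smul_eq_mul, div_mul_cancel₀ _ hcc.ne'] at this
  linarith

theorem isIrredundantVRep_upperImage_iff (ha : ∀ i, a i ≠ ⊤) (hd : 1 ≤ d)
    (hv : (Set.extremePoints ℝ (upperImage a B P)).Nonempty) {Y : Set (Gen (d + 1))} :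
    IsIrredundantVRep Y (upperImage a B P) ↔
      IsIrredundantHRep Y (fun y ys => coupling y ys) (lowerImage a B P) := by
  have hsub : ∀ (g : Gen (d + 1)), Y.Finite → (Y \ {g}).Finite := fun g h =>
    h.subset Set.sdiff_subset
  constructor
  · intro h
    obtain ⟨hfin, -, hgen⟩ := h.1
    refine ⟨⟨hfin, fun g hg => isHalfspace_of_slope_ne_zero
      (slope_ne_zero_of_isIrredundantVRep ha hd hv h hg),
      (generated_eq_upperImage_iff ha hd hv hfin).1 hgen⟩, fun g hg hrep => ?_⟩
    exact h.2 g hg (isVRep_of_isHRep ha hd hv hrep)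
  · intro h
    refine ⟨isVRep_of_isHRep ha hd hv h.1, fun g hg hrep => h.2 g hg ?_⟩
    -- The half-space condition is inherited from the full system, so irredundancy of the smaller
    -- family is not needed.
    exact ⟨hrep.1, fun k hk => h.1.2.1 k hk.1,
      (generated_eq_upperImage_iff ha hd hv hrep.1).1 hrep.2.2⟩

end GeometricDuality
end MOLP

theorem theorem1 {m n d : ℕ} (a : Fin m → EReal) (ha : ∀ i, a i ≠ ⊤)
    (B : Matrix (Fin m) (Fin n) ℝ) (P : Matrix (Fin (d + 1)) (Fin n) ℝ)
    (hvertex : (Set.extremePoints ℝ (MOLP.upperImage a B P)).Nonempty) :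
    (2 ≤ d + 1 → ∀ Y : Set (MOLP.Gen (d + 1)), Y.Finite →
      (MOLP.IsIrredundantVRep Y (MOLP.upperImage a B P) ↔
        MOLP.IsIrredundantHRep Y (fun y ys => MOLP.coupling y ys) (MOLP.lowerImage a B P))) ∧
    (∀ W : Set (Fin (d + 1) → ℝ), W.Finite →
      (MOLP.IsIrredundantVRep
          (MOLP.Gen.point '' W ∪ {MOLP.Gen.direction (MOLP.downDirection d)})
          (MOLP.lowerImage a B P) ↔
        MOLP.IsIrredundantHRep W (fun ys y => MOLP.coupling (MOLP.Gen.point y) ys)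
          (MOLP.upperImage a B P))) :=
  ⟨fun hd _ _ => MOLP.isIrredundantVRep_upperImage_iff ha (by omega) hvertex,
    fun _ hW => MOLP.isIrredundantVRep_withDown_iff ha (hvertex.mono fun _ h => h.1)
      (MOLP.lowerImage_nonempty ha hvertex) hW⟩
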